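/- Let $d\ge 1$ and let $\Pi\subset\mathbb R^d$ be an arbitrary origin-symmetric parallelepiped, i.e. $\Pi=A[-1,1]^d$ for some invertible linear operator $A$ of $\mathbb R^d$. For a unit vector $e$ let $\operatorname{vol}_e(\Pi)$ denote the $(d-1)$-dimensional volume of the intersection of $\Pi$ with the hyperplane through the origin orthogonal to $e$, and let $$\Pi^\wedge=\{\lambda e \;:\; e\in\mathbb R^d,\ |e|=1,\ 0\le\lambda\le 2^{1-d}\operatorname{vol}_e(\Pi)\}$$ be the section-dual body of $\Pi$. For a set $M\subset\mathbb R^d$ let $\mu_k(M,\mathbb Z^d)$ denote its $k$-th successive minimum, i.e. the least (infimum of the) $\mu>0$ such that $\mu M$ contains $k$ linearly independent points of $\mathbb Z^d$. If $\mu_1(\Pi^\wedge,\mathbb Z^d)\le 1$ (equivalently, if $\Pi^\wedge$ contains a nonzero integer point), then $$\prod_{k=1}^{d-1}\mu_k(\Pi,\mathbb Z^d)\le 1 .$$ -/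

import Mathlib

open MeasureTheory
open scoped Pointwise RealInnerProductSpace

noncomputable section

namespace SectionDual

/-- The integer lattice `ℤ^d` in Euclidean space `ℝ^d`. -/
def integerLattice (d : ℕ) : Submodule ℤ (EuclideanSpace ℝ (Fin d)) :=
  Submodule.span ℤ (Set.range (EuclideanSpace.basisFun (Fin d) ℝ).toBasis)

/-- The cube `[-1, 1]^d`. -/
def cube (d : ℕ) : Set (EuclideanSpace ℝ (Fin d)) :=
  {x | ∀ i, |x i| ≤ 1}

/-- A (nondegenerate, closed) parallelepiped symmetric about the origin: an image of the cube
`[-1, 1]^d` under an invertible linear operator. -/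
def IsSymmParallelepiped {d : ℕ} (P : Set (EuclideanSpace ℝ (Fin d))) : Prop :=
  ∃ A : EuclideanSpace ℝ (Fin d) ≃ₗ[ℝ] EuclideanSpace ℝ (Fin d), P = A '' cube d

/-- The `k`-th successive minimum of `M` with respect to the lattice `L`: the least positive `μ`
such that `μ • M` contains `k` linearly independent points of `L`. -/
def successiveMin {d : ℕ} (M : Set (EuclideanSpace ℝ (Fin d)))
    (L : Submodule ℤ (EuclideanSpace ℝ (Fin d))) (k : ℕ) : ℝ :=
  sInf {μ : ℝ | 0 < μ ∧ ∃ v : Fin k → EuclideanSpace ℝ (Fin d),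
    LinearIndependent ℝ v ∧ ∀ i, v i ∈ L ∧ v i ∈ μ • M}

/-- The volume of the intersection of `P` with the orthogonal complement of the line spanned by
`e`. The measure is the Lebesgue measure of the Euclidean space `(ℝ ∙ e)ᗮ`, which has dimension
`d - 1` when `e ≠ 0`. -/
def sectionVolume {d : ℕ} (P : Set (EuclideanSpace ℝ (Fin d)))
    (e : EuclideanSpace ℝ (Fin d)) : ℝ :=
  (volume : Measure (Submodule.span ℝ {e})ᗮ).real
    {x | (x : EuclideanSpace ℝ (Fin d)) ∈ P}

/-- The section-dual `P^∧` of `P`: all `t • e` with `e` a Euclidean unit vector and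
`0 ≤ t ≤ 2^(1-d) vol_e(P)`. -/
def sectionDual {d : ℕ} (P : Set (EuclideanSpace ℝ (Fin d))) :
    Set (EuclideanSpace ℝ (Fin d)) :=
  {x | ∃ e ∈ Metric.sphere (0 : EuclideanSpace ℝ (Fin d)) 1, ∃ t : ℝ,
    0 ≤ t ∧ t ≤ (2 : ℝ) ^ (1 - (d : ℤ)) * sectionVolume P e ∧ x = t • e}

end SectionDual

end

/-!
The section-dual turns an integer vector `a` in `c • P^∧` into a lower bound
`2 ^ (d - 1) * ‖a‖ ≤ c * vol_e(P)` for the section of `P` by the hyperplane orthogonal to `a`,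
where `e = a / ‖a‖`. The integer points of that hyperplane form a lattice of rank `d - 1` and
covolume at most `‖a‖`, and Minkowski's second theorem, applied to the section and to this
lattice, bounds the product of the `d - 1` successive minima of the section, which are not
smaller than those of `P`, by `2 ^ (d - 1) * ‖a‖ / vol_e(P) ≤ c`. Since `c > 1` is arbitrary,
the product is at most `1`.

Minkowski's second theorem is proved in packing form. Linearly independent lattice points
`v 0, …, v n` are chosen greedily (`exists_greedy_seq`), so that a lattice point of size less than
that of `v j` lies in the span of `v 0, …, v (j - 1)`. The ball whose radius is half the size of
`v n` is then squeezed along the spans of `v 0, …, v j`, `j < n`, by the ratio of the sizes of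
`v j` and `v (j + 1)` (`exists_squeeze`). Although the result need not be convex, its volume is
known, and no difference of two of its points is a nonzero lattice point
(`exists_packing_set`).

The covolume does not have to be computed: a subset of the hyperplane without nonzero integer
differences, thickened to height `1 / ‖a‖`, is a subset of `ℝ^d` with the same property
(`volume_le_norm_of_no_integer_difference`), hence of volume at most `1` by Blichfeldt's
principle.
-/

namespace SectionDual

/-! ### Squeezing a set along a subspace -/

section Squeezing

variable {E : Type*} [NormedAddCommGroup E] [NormedSpace ℝ E] [FiniteDimensional ℝ E]
  [MeasurableSpace E] [BorelSpace E] (μ : Measure E) [μ.IsAddHaarMeasure]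

/-- The squeezing lemma. Let `V` be the range of the projection `Q`. Every fibre of a convex
open set `K` over `E ⧸ V` is shrunk by the factor `θ` towards a point of the same fibre; the
centres, taken from a countable dense set, depend on the fibre only and in a measurable way. So
`A ⊆ K` is moved to a subset of `K`, and differences lying in `V` are multiplied by `θ`. -/
theorem exists_squeeze {K : Set E} (hKo : IsOpen K) (hKc : Convex ℝ K) (Q : E →ₗ[ℝ] E)
    (hQ : ∀ x, Q (Q x) = Q x) {θ : ℝ} (hθ : 0 < θ) (hθ1 : θ ≤ 1) {A : Set E}
    (hA : MeasurableSet A) (hAK : A ⊆ K) :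
    ∃ B : Set E, MeasurableSet B ∧ B ⊆ K ∧
      μ B = ENNReal.ofReal |LinearMap.det (LinearMap.id - (1 - θ) • Q)| * μ A ∧
      ∀ x ∈ B, ∀ y ∈ B, Q (x - y) = x - y →
        ∃ u ∈ A, ∃ w ∈ A, Q (u - w) = u - w ∧ x - y = θ • (u - w) := by
  set T : E →ₗ[ℝ] E := LinearMap.id - (1 - θ) • Q with hT
  have hTx : ∀ x, T x = x - (1 - θ) • Q x := fun x => by simp [hT]
  have hQc : Continuous Q := Q.continuous_of_finiteDimensional
  have hTc : Continuous T := T.continuous_of_finiteDimensional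
  have hQT : ∀ x, Q (T x) = θ • Q x := fun x => by
    rw [hTx, map_sub, map_smul, hQ]; module
  have hTinj : Function.Injective T := by
    intro x y hxy
    have h1 : Q x = Q y := by
      have := congrArg Q hxy
      rw [hQT, hQT] at this
      exact smul_right_injective E hθ.ne' this
    rw [hTx, hTx, h1] at hxy
    simpa using hxy
  let q : ℕ → E := TopologicalSpace.denseSeq E
  let Z : ℕ → Set E := fun m => {y | y + Q (q m) ∈ K}
  let D : ℕ → Set E := fun m => (fun x => x - Q x) ⁻¹' (disjointed Z m)
  let c : ℕ → E := fun m => (1 - θ) • Q (q m)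
  have hZ : ∀ m, MeasurableSet (Z m) := fun m =>
    (hKo.preimage (by fun_prop : Continuous fun y : E => y + Q (q m))).measurableSet
  have hD : ∀ m, MeasurableSet (D m) := fun m =>
    (MeasurableSet.disjointed hZ m).preimage (by fun_prop : Continuous _).measurable
  have hDdisj : ∀ {m m' : ℕ} {x x' : E}, x - Q x = x' - Q x' → x ∈ D m → x' ∈ D m' →
      m = m' := by
    intro m m' x x' hxx hx hx'
    by_contra hne
    have hx2 : x - Q x ∈ disjointed Z m' := hxx ▸ hx'
    exact Set.disjoint_left.mp (disjoint_disjointed Z hne) hx hx2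
  have hcover : A ⊆ ⋃ m, D m := by
    intro x hx
    have hop : IsOpen {z | x - Q x + Q z ∈ K} :=
      hKo.preimage (by fun_prop : Continuous fun z : E => x - Q x + Q z)
    obtain ⟨m, hm⟩ := (TopologicalSpace.denseRange_denseSeq E).exists_mem_open hop
      ⟨x, by simpa using hAK hx⟩
    have : x - Q x ∈ ⋃ m, disjointed Z m := by
      rw [iUnion_disjointed]
      exact Set.mem_iUnion.2 ⟨m, hm⟩
    simpa [D] using this
  let Φ : ℕ → E → E := fun m x => T x + c m
  have hΦQ : ∀ m x, Φ m x - Q (Φ m x) = x - Q x := by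
    intro m x
    have h1 : Q (Φ m x) = θ • Q x + (1 - θ) • Q (q m) := by
      simp only [Φ, c, map_add, hQT, map_smul, hQ]
    rw [h1]
    simp only [Φ, c, hTx]
    module
  have hpiece : ∀ m, MeasurableSet (Φ m '' (A ∩ D m)) := by
    intro m
    refine (hA.inter (hD m)).image_of_continuousOn_injOn
      (by fun_prop : Continuous (Φ m)).continuousOn (Function.Injective.injOn ?_)
    exact (add_left_injective (c m)).comp hTinj
  have hpd : Pairwise (Function.onFun Disjoint fun m => Φ m '' (A ∩ D m)) := by
    intro m m' hne
    refine Set.disjoint_left.2 ?_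
    rintro _ ⟨x, hx, rfl⟩ ⟨y, hy, hxy⟩
    refine hne (hDdisj ?_ hx.2 hy.2)
    rw [← hΦQ m x, ← hΦQ m' y, hxy]
  refine ⟨⋃ m, Φ m '' (A ∩ D m), MeasurableSet.iUnion hpiece, ?_, ?_, ?_⟩
  · refine Set.iUnion_subset fun m => ?_
    rintro _ ⟨x, hx, rfl⟩
    have h1 : x - Q x + Q (q m) ∈ K := disjointed_subset Z m hx.2
    have h2 := hKc (hAK hx.1) h1 hθ.le (sub_nonneg.2 hθ1) (by ring)
    convert h2 using 1
    simp only [Φ, c, hTx]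
    module
  · have hcov : A = ⋃ m, A ∩ D m := by
      rw [← Set.inter_iUnion, Set.inter_eq_left.2 hcover]
    have hdis : Pairwise (Function.onFun Disjoint fun m => A ∩ D m) := by
      intro m m' hne
      refine Set.disjoint_left.2 fun x hx hy => hne (hDdisj rfl hx.2 hy.2)
    rw [measure_iUnion hpd hpiece]
    conv_rhs => rw [hcov, measure_iUnion hdis fun m => hA.inter (hD m)]
    rw [← ENNReal.tsum_mul_left]
    refine tsum_congr fun m => ?_
    have : Φ m '' (A ∩ D m) = (fun x => x + c m) '' (T '' (A ∩ D m)) := by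
      rw [Set.image_image]
    rw [this, Set.image_add_right, measure_preimage_add_right,
      Measure.addHaar_image_linearMap]
  · intro x hx y hy hxy
    obtain ⟨m, u, hu, rfl⟩ := Set.mem_iUnion.1 hx
    obtain ⟨m', w, hw, rfl⟩ := Set.mem_iUnion.1 hy
    have huw : u - Q u = w - Q w := by
      rw [← hΦQ m u, ← hΦQ m' w]
      rw [map_sub] at hxy
      exact sub_eq_sub_iff_sub_eq_sub.1 hxy.symm
    obtain rfl := hDdisj huw hu.2 hw.2
    have hQ' : Q (u - w) = u - w := by
      rw [map_sub]
      exact (sub_eq_sub_iff_sub_eq_sub.1 huw).symm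
    refine ⟨u, hu.1, w, hw.1, hQ', ?_⟩
    have : Φ m u - Φ m w = T (u - w) := by simp [Φ]
    rw [this, hTx, hQ']
    module

end Squeezing

/-! ### Minkowski's packing set -/

section Packing

variable {E : Type*} [NormedAddCommGroup E] [NormedSpace ℝ E]

/-- The projection onto the span of the first `k` vectors of a basis that annihilates the other
basis vectors. -/
noncomputable def truncation {n : ℕ} (b : Module.Basis (Fin n) ℝ E) (k : ℕ) : E →ₗ[ℝ] E :=
  b.constr ℝ fun i => if (i : ℕ) < k then b i else 0

theorem repr_truncation {n : ℕ} (b : Module.Basis (Fin n) ℝ E) (k : ℕ) (x : E) (i : Fin n) :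
    b.repr (truncation b k x) i = if (i : ℕ) < k then b.repr x i else 0 := by
  rw [truncation, Module.Basis.constr_apply_fintype, map_sum, Finset.sum_apply']
  rw [Finset.sum_eq_single i]
  · split_ifs <;> simp [Module.Basis.equivFun_apply]
  · intro j _ hj
    split_ifs <;> simp [hj]
  · simp

theorem truncation_eq_self_iff {n : ℕ} (b : Module.Basis (Fin n) ℝ E) (k : ℕ) (x : E) :
    truncation b k x = x ↔ ∀ i : Fin n, k ≤ i → b.repr x i = 0 := by
  rw [b.ext_elem_iff]
  refine forall_congr' fun i => ?_
  rw [repr_truncation]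
  split_ifs with h
  · simp [h]
  · simp [not_lt.1 h, eq_comm]

theorem truncation_truncation {n : ℕ} (b : Module.Basis (Fin n) ℝ E) (k : ℕ) (x : E) :
    truncation b k (truncation b k x) = truncation b k x := by
  rw [truncation_eq_self_iff]
  intro i hi
  rw [repr_truncation, if_neg (not_lt.2 hi)]

theorem det_id_sub_smul_truncation {n : ℕ} (b : Module.Basis (Fin n) ℝ E) {k : ℕ} (hk : k ≤ n)
    (θ : ℝ) : LinearMap.det (LinearMap.id - (1 - θ) • truncation b k) = θ ^ k := by
  have hM : LinearMap.toMatrix b b (LinearMap.id - (1 - θ) • truncation b k) =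
      Matrix.diagonal fun i : Fin n => if (i : ℕ) < k then θ else 1 := by
    ext i j
    rw [LinearMap.toMatrix_apply]
    simp only [LinearMap.sub_apply, LinearMap.id_apply, LinearMap.smul_apply, map_sub, map_smul,
      Finsupp.sub_apply, Finsupp.smul_apply, repr_truncation, Module.Basis.repr_self,
      Matrix.diagonal_apply, Finsupp.single_apply]
    by_cases hij : i = j
    · subst hij
      by_cases h : (i : ℕ) < k <;> simp [h]
    · simp [hij, Ne.symm hij]
  rw [← LinearMap.det_toMatrix b, hM, Matrix.det_diagonal, Finset.prod_ite]
  rw [Finset.prod_const, Finset.prod_const_one, mul_one, Fin.card_filter_val_lt,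
    min_eq_right hk]

variable [FiniteDimensional ℝ E] [MeasurableSpace E] [BorelSpace E] (μ : Measure E)
  [μ.IsAddHaarMeasure]

/-- The set obtained from the ball of radius `R` by squeezing along `span (b 0)`,
`span (b 0, b 1)`, …, in this order, with the factors `r j / r (j + 1)`. -/
theorem exists_iterated_squeeze {n : ℕ} (b : Module.Basis (Fin (n + 1)) ℝ E) (p : Seminorm ℝ E)
    (hpc : Continuous p) (r : ℕ → ℝ) (hr : ∀ j ≤ n, 0 < r j) (hmono : ∀ j < n, r j ≤ r (j + 1)) (R : ℝ)
    {k : ℕ} (hk : k ≤ n) :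
    ∃ A : Set E, MeasurableSet A ∧ A ⊆ p.ball 0 R ∧
      μ A = ENNReal.ofReal ((∏ j ∈ Finset.range k, r j) / r k ^ k) * μ (p.ball 0 R) ∧
      ∀ x ∈ A, ∀ y ∈ A, ∀ j ≤ k, truncation b (j + 1) (x - y) = x - y →
        p (x - y) < r j / r k * (2 * R) := by
  have hdiff : ∀ x ∈ p.ball 0 R, ∀ y ∈ p.ball 0 R, p (x - y) < 2 * R := by
    intro x hx y hy
    rw [Seminorm.mem_ball_zero] at hx hy
    have := map_sub_le_add p x y
    linarith
  have hopen : IsOpen (p.ball 0 R) := by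
    rw [Seminorm.ball_zero_eq]
    exact isOpen_lt hpc continuous_const
  induction k with
  | zero =>
    refine ⟨p.ball 0 R, hopen.measurableSet, subset_rfl, by simp, ?_⟩
    intro x hx y hy j hj _
    obtain rfl : j = 0 := by omega
    rw [div_self (hr 0 (by omega)).ne', one_mul]
    exact hdiff x hx y hy
  | succ k ih =>
    obtain ⟨A, hAm, hAK, hμ, hA⟩ := ih (by omega)
    have hrk := hr k (by omega)
    have hrk1 := hr (k + 1) hk
    have hθ : 0 < r k / r (k + 1) := div_pos hrk hrk1
    obtain ⟨B, hBm, hBK, hBμ, hB⟩ := exists_squeeze μ hopen (p.convex_ball 0 R)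
      (truncation b (k + 1)) (truncation_truncation b _) hθ
      ((div_le_one hrk1).2 (hmono k (by omega))) hAm hAK
    refine ⟨B, hBm, hBK, ?_, ?_⟩
    · rw [hBμ, hμ, det_id_sub_smul_truncation b (by omega), ← mul_assoc,
        ← ENNReal.ofReal_mul (abs_nonneg _), abs_of_pos (pow_pos hθ _), Finset.prod_range_succ]
      congr 2
      rw [div_pow]
      field_simp
      ring
    · intro x hx y hy j hj hxy
      rcases hj.lt_or_eq with hj | rfl
      · have hxy' : truncation b (k + 1) (x - y) = x - y := by
          rw [truncation_eq_self_iff] at hxy ⊢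
          exact fun i hi => hxy i (by omega)
        obtain ⟨u, hu, w, hw, -, huw⟩ := hB x hx y hy hxy'
        have huw' : truncation b (j + 1) (u - w) = u - w := by
          rw [huw, map_smul] at hxy
          exact smul_right_injective E hθ.ne' hxy
        have h1 := hA u hu w hw j (by omega) huw'
        rw [huw, map_smul_eq_mul, Real.norm_of_nonneg hθ.le]
        calc _ < r k / r (k + 1) * (r j / r k * (2 * R)) := by gcongr
          _ = _ := by field_simp
      · rw [div_self hrk1.ne', one_mul]
        exact hdiff x (hBK hx) y (hBK hy)

/-- The packing set behind Minkowski's second theorem. If every point of `L` whose `p`-size is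
less than `r j` lies in the span of the first `j` basis vectors, then some measurable set of
measure `∏ j, r j / 2` times that of the unit ball of `p` has no nonzero difference in `L`. -/
theorem exists_packing_set {n : ℕ} (b : Module.Basis (Fin (n + 1)) ℝ E) (p : Seminorm ℝ E)
    (hpc : Continuous p) (r : ℕ → ℝ) (hr : ∀ j ≤ n, 0 < r j) (hmono : ∀ j < n, r j ≤ r (j + 1)) (L : Set E)
    (hL : ∀ x ∈ L, ∀ j ≤ n, p x < r j → truncation b j x = x) :
    ∃ A : Set E, MeasurableSet A ∧
      μ A = ENNReal.ofReal (∏ j ∈ Finset.range (n + 1), r j / 2) * μ (p.ball 0 1) ∧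
      ∀ x ∈ A, ∀ y ∈ A, x - y ∈ L → x = y := by
  have hrn := hr n le_rfl
  obtain ⟨A, hAm, -, hμ, hA⟩ := exists_iterated_squeeze μ b p hpc r hr hmono (r n / 2) le_rfl
  refine ⟨A, hAm, ?_, ?_⟩
  · have hball : p.ball 0 (r n / 2) = (r n / 2) • p.ball 0 1 := by
      rw [p.smul_ball_zero (by positivity), Real.norm_of_nonneg (by positivity), mul_one]
    have hprod : 0 ≤ ∏ j ∈ Finset.range n, r j :=
      Finset.prod_nonneg fun j hj => (hr j (Finset.mem_range.1 hj).le).le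
    rw [hμ, hball, Measure.addHaar_smul_of_nonneg μ (by positivity), ← mul_assoc,
      ← ENNReal.ofReal_mul (by positivity), Module.finrank_eq_card_basis b, Fintype.card_fin,
      Finset.prod_div_distrib, Finset.prod_range_succ, Finset.prod_const, Finset.card_range]
    congr 2
    rw [div_pow]
    field_simp
    ring
  · intro x hx y hy hxy
    -- Descending induction: `x - y` lies in the span of the first `j` basis vectors for all `j`.
    have key : ∀ m ≤ n + 1, truncation b (n + 1 - m) (x - y) = x - y := by
      intro m
      induction m with
      | zero =>
        intro _
        rw [truncation_eq_self_iff]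
        intro i hi
        omega
      | succ m ih =>
        intro hm
        have h1 := ih (by omega)
        have h2 : n + 1 - m = (n + 1 - (m + 1)) + 1 := by omega
        rw [h2] at h1
        refine hL _ hxy _ (by omega) ?_
        have := hA x hx y hy _ (by omega) h1
        rwa [mul_div_cancel₀ _ two_ne_zero, div_mul_cancel₀ _ hrn.ne'] at this
    have h0 := key (n + 1) le_rfl
    rw [truncation_eq_self_iff] at h0
    refine sub_eq_zero.1 (b.ext_elem fun i => ?_)
    simpa using h0 i (by omega)

end Packing

/-! ### Vectors realizing the successive minima -/

section Greedy

variable {E : Type*} [AddCommGroup E] [Module ℝ E]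

/-- Choosing greedily, at each step, a point of `L` outside the span of the previous ones and of
least size `p`. -/
theorem exists_greedy_seq [FiniteDimensional ℝ E] {n : ℕ} (hn : Module.finrank ℝ E = n + 1)
    (p : E → ℝ) (L : Set E) (hspan : Submodule.span ℝ L = ⊤)
    (hfin : ∀ C, {x ∈ L | p x ≤ C}.Finite) :
    ∃ v : ℕ → E, ∀ k ≤ n, v k ∈ L ∧ v k ∉ Submodule.span ℝ (v '' Set.Iio k) ∧
      ∀ x ∈ L, p x < p (v k) → x ∈ Submodule.span ℝ (v '' Set.Iio k) := by
  have step : ∀ W : Submodule ℝ E, W ≠ ⊤ → ∃ x ∈ L, x ∉ W ∧ ∀ y ∈ L, p y < p x → y ∈ W := by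
    intro W hW
    obtain ⟨x₀, hx₀, hx₀W⟩ : ∃ x ∈ L, x ∉ W := by
      by_contra! hcon
      exact hW (top_le_iff.1 (hspan ▸ Submodule.span_le.2 hcon))
    obtain ⟨x, ⟨⟨hxL, hx⟩, hxW⟩, hmin⟩ := Set.exists_min_image ({x ∈ L | p x ≤ p x₀} \ W) p
      ((hfin _).subset Set.sdiff_subset) ⟨x₀, ⟨hx₀, le_rfl⟩, hx₀W⟩
    refine ⟨x, hxL, hxW, fun y hy hyx => ?_⟩
    by_contra hyW
    exact hyx.not_ge (hmin y ⟨⟨hy, hyx.le.trans hx⟩, hyW⟩)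
  have main : ∀ m ≤ n + 1, ∃ v : ℕ → E, ∀ k < m, v k ∈ L ∧
      v k ∉ Submodule.span ℝ (v '' Set.Iio k) ∧
      ∀ x ∈ L, p x < p (v k) → x ∈ Submodule.span ℝ (v '' Set.Iio k) := by
    intro m
    induction m with
    | zero => exact fun _ => ⟨0, by simp⟩
    | succ m ih =>
      intro hm
      obtain ⟨v, hv⟩ := ih (by omega)
      have hW : Submodule.span ℝ (v '' Set.Iio m) ≠ ⊤ := by
        intro htop
        classical
        have h1 := finrank_span_finset_le_card (R := ℝ) ((Finset.range m).image v)
        rw [Finset.coe_image, Finset.coe_range, Set.finrank, htop, finrank_top, hn] at h1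
        have h2 := Finset.card_image_le (s := Finset.range m) (f := v)
        rw [Finset.card_range] at h2
        omega
      obtain ⟨x, hx⟩ := step _ hW
      refine ⟨Function.update v m x, fun k hk => ?_⟩
      have himg : Function.update v m x '' Set.Iio k = v '' Set.Iio k := by
        refine Set.image_congr fun i hi => Function.update_of_ne ?_ _ _
        have : i < k := hi
        omega
      rw [himg]
      rcases (Nat.lt_succ_iff.1 hk).lt_or_eq with hk | rfl
      · rw [Function.update_of_ne hk.ne]
        exact hv k hk
      · rw [Function.update_self]
        exact hx
  obtain ⟨v, hv⟩ := main (n + 1) le_rfl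
  exact ⟨v, fun k hk => hv k (by omega)⟩

theorem linearIndependent_of_notMem_span_image_Iio {v : ℕ → E} {m : ℕ}
    (hv : ∀ k < m, v k ∉ Submodule.span ℝ (v '' Set.Iio k)) :
    LinearIndependent ℝ fun i : Fin m => v i := by
  induction m with
  | zero => exact linearIndependent_empty_type
  | succ m ih =>
    rw [linearIndependent_finSucc']
    refine ⟨ih fun k hk => hv k (by omega), ?_⟩
    have hrange : Set.range (Fin.init fun i : Fin (m + 1) => v i) = v '' Set.Iio m := by
      ext x
      constructor
      · rintro ⟨i, rfl⟩
        exact ⟨i, i.2, rfl⟩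
      · rintro ⟨i, hi, rfl⟩
        exact ⟨⟨i, hi⟩, rfl⟩
    rw [hrange]
    exact hv m (Nat.lt_succ_self m)

end Greedy

/-- The upper bound of Minkowski's second theorem, in packing form: linearly independent points
`v 0, …, v n` of `L`, of nondecreasing sizes, and a set of measure
`∏ k, p (v k) / 2` times that of the unit ball without nonzero differences in `L`. -/
theorem exists_minima_and_packing_set {E : Type*} [NormedAddCommGroup E] [NormedSpace ℝ E]
    [FiniteDimensional ℝ E] [MeasurableSpace E] [BorelSpace E] (μ : Measure E)
    [μ.IsAddHaarMeasure] {n : ℕ} (hn : Module.finrank ℝ E = n + 1) (p : Seminorm ℝ E)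
    (hpc : Continuous p) (hp0 : ∀ x, p x = 0 → x = 0) (L : Set E)
    (hspan : Submodule.span ℝ L = ⊤) (hfin : ∀ C, {x ∈ L | p x ≤ C}.Finite) :
    ∃ v : ℕ → E, (∀ k ≤ n, v k ∈ L) ∧ (∀ k ≤ n, 0 < p (v k)) ∧
      (∀ k ≤ n, ∀ i ≤ k, p (v i) ≤ p (v k)) ∧
      LinearIndependent ℝ (fun i : Fin (n + 1) => v i) ∧
      ∃ A : Set E, MeasurableSet A ∧
        μ A = ENNReal.ofReal (∏ k ∈ Finset.range (n + 1), p (v k) / 2) * μ (p.ball 0 1) ∧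
        ∀ x ∈ A, ∀ y ∈ A, x - y ∈ L → x = y := by
  obtain ⟨v, hv⟩ := exists_greedy_seq hn p L hspan hfin
  have hli : LinearIndependent ℝ (fun i : Fin (n + 1) => v i) :=
    linearIndependent_of_notMem_span_image_Iio fun k hk => (hv k (by omega)).2.1
  have hpos : ∀ k ≤ n, 0 < p (v k) := by
    intro k hk
    refine (apply_nonneg p _).lt_of_ne' fun h => (hv k hk).2.1 ?_
    rw [hp0 _ h]
    exact zero_mem _
  have hmono : ∀ k ≤ n, ∀ i ≤ k, p (v i) ≤ p (v k) := by
    intro k hk i hik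
    by_contra! hlt
    refine (hv k hk).2.1 (Submodule.span_mono (Set.image_mono ?_)
      ((hv i (hik.trans hk)).2.2 _ (hv k hk).1 hlt))
    exact Set.Iio_subset_Iio hik
  let b := basisOfLinearIndependentOfCardEqFinrank hli (by simp [hn])
  have hb : ∀ i : Fin (n + 1), b i = v i := fun i => by simp [b]
  refine ⟨v, fun k hk => (hv k hk).1, hpos, hmono, hli, ?_⟩
  refine exists_packing_set μ b p hpc (fun k => p (v k)) hpos
    (fun k hk => hmono _ hk _ (Nat.le_succ k)) L fun x hx k hk hxk => ?_
  have hle : Submodule.span ℝ (v '' Set.Iio k) ≤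
      LinearMap.eqLocus (truncation b k) LinearMap.id := by
    rw [Submodule.span_le]
    rintro _ ⟨i, hi, rfl⟩
    have hik : i < k := hi
    have h1 := hb ⟨i, by omega⟩
    rw [SetLike.mem_coe, LinearMap.mem_eqLocus, ← h1, truncation, Module.Basis.constr_basis]
    simp [hik]
  exact hle ((hv k hk).2.2 x hx hxk)

/-! ### Packings by integer translates -/

theorem mem_integerLattice_iff {d : ℕ} {x : EuclideanSpace ℝ (Fin d)} :
    x ∈ integerLattice d ↔ ∀ i, ∃ z : ℤ, (z : ℝ) = x i := by
  rw [integerLattice, Module.Basis.mem_span_iff_repr_mem]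
  simp

theorem volume_le_one_of_no_integer_difference {d : ℕ} {B : Set (EuclideanSpace ℝ (Fin d))}
    (hB : MeasurableSet B) (hdiff : ∀ x ∈ B, ∀ y ∈ B, x - y ∈ integerLattice d → x = y) :
    volume B ≤ 1 := by
  let b := EuclideanSpace.basisFun (Fin d) ℝ
  have hvol : volume (ZSpan.fundamentalDomain b.toBasis) = 1 := by
    rw [measure_congr (ZSpan.fundamentalDomain_ae_parallelepiped b.toBasis volume),
      OrthonormalBasis.coe_toBasis, OrthonormalBasis.volume_parallelepiped]
  have hfund := ZSpan.isAddFundamentalDomain' b.toBasis volume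
  have : Countable (Submodule.span ℤ (Set.range b.toBasis)).toAddSubgroup :=
    inferInstanceAs (Countable (Submodule.span ℤ (Set.range b.toBasis)))
  by_contra! hlt
  rw [← hvol] at hlt
  obtain ⟨x, y, hxy, h⟩ :=
    exists_pair_mem_lattice_not_disjoint_vadd hfund hB.nullMeasurableSet hlt
  obtain ⟨_, ⟨u, hu, rfl⟩, w, hw, huw⟩ := Set.not_disjoint_iff.1 h
  have huw' : (y : EuclideanSpace ℝ (Fin d)) + w = x + u := huw
  have hsub : u - w = (y : EuclideanSpace ℝ (Fin d)) - x := by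
    rw [sub_eq_sub_iff_add_eq_add, add_comm, ← huw', add_comm]
  have hmem : u - w ∈ integerLattice d := by
    rw [hsub]
    exact sub_mem (S := Submodule ℤ _) y.2 x.2
  have huw0 := hdiff u hu w hw hmem
  rw [huw0, sub_self] at hsub
  exact hxy (Subtype.ext (sub_eq_zero.1 hsub.symm).symm)

/-- A set `A` in the hyperplane orthogonal to an integer vector `a` without nonzero integer
differences has volume at most `‖a‖`. Indeed `A` thickened to the height `1 / ‖a‖` has no
such differences either: for integer `z` the number `⟪a, z⟫` is an integer. -/
theorem volume_le_norm_of_no_integer_difference {d : ℕ} {e a : EuclideanSpace ℝ (Fin d)}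
    (he : ‖e‖ = 1) (ha : a ∈ integerLattice d) (ha0 : a ≠ 0) (hae : a = ‖a‖ • e)
    {A : Set (Submodule.span ℝ {e})ᗮ} (hA : MeasurableSet A)
    (hdiff : ∀ x ∈ A, ∀ y ∈ A, ((x - y : (Submodule.span ℝ {e})ᗮ) : EuclideanSpace ℝ (Fin d)) ∈
      integerLattice d → x = y) :
    volume A ≤ ENNReal.ofReal ‖a‖ := by
  have hna : 0 < ‖a‖ := norm_pos_iff.2 ha0
  let K := Submodule.span ℝ {e}
  let S : Set K := {w | ⟪e, (w : EuclideanSpace ℝ (Fin d))⟫ ∈ Set.Ico 0 ‖a‖⁻¹}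
  have hSm : MeasurableSet S :=
    measurableSet_Ico.preimage (by fun_prop : Continuous fun w : K =>
      ⟪e, (w : EuclideanSpace ℝ (Fin d))⟫).measurable
  have hSvol : volume S = ENNReal.ofReal ‖a‖⁻¹ := by
    let f := LinearIsometryEquiv.toSpanUnitSingleton (𝕜 := ℝ) e he
    rw [← f.measurePreserving.measure_preimage hSm.nullMeasurableSet]
    have : f ⁻¹' S = Set.Ico 0 ‖a‖⁻¹ := by
      ext t
      have h1 : ⟪e, ((f t : K) : EuclideanSpace ℝ (Fin d))⟫ = t := by
        change ⟪e, t • e⟫ = t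
        rw [inner_smul_right, real_inner_self_eq_norm_sq, he]
        simp
      change ⟪e, ((f t : K) : EuclideanSpace ℝ (Fin d))⟫ ∈ Set.Ico 0 ‖a‖⁻¹ ↔ _
      rw [h1]
    rw [this, Real.volume_Ico, sub_zero]
  let F : EuclideanSpace ℝ (Fin d) → K × Kᗮ := fun x => (K.orthogonalDecomposition x).ofLp
  have hF : MeasurePreserving F :=
    (WithLp.volume_preserving_ofLp K Kᗮ).comp K.orthogonalDecomposition.measurePreserving
  have hFx : ∀ x, ((F x).1 : EuclideanSpace ℝ (Fin d)) + (F x).2 = x := by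
    intro x
    have := K.orthogonalDecomposition.symm_apply_apply x
    rwa [Submodule.orthogonalDecomposition_symm_apply] at this
  have hinner : ∀ x, ⟪e, ((F x).1 : EuclideanSpace ℝ (Fin d))⟫ = ⟪e, x⟫ := by
    intro x
    have h0 : ⟪e, ((F x).2 : EuclideanSpace ℝ (Fin d))⟫ = 0 :=
      Submodule.mem_orthogonal_singleton_iff_inner_right.1 (F x).2.2
    conv_rhs => rw [← hFx x, inner_add_right, h0, add_zero]
  have hone : volume (F ⁻¹' (S ×ˢ A)) ≤ 1 := by
    refine volume_le_one_of_no_integer_difference ((hSm.prod hA).preimage hF.measurable) ?_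
    rintro x ⟨⟨hx0, hx1⟩, hxA⟩ y ⟨⟨hy0, hy1⟩, hyA⟩ hxy
    rw [hinner] at hx0 hx1 hy0 hy1
    have hzero : ⟪e, x - y⟫ = 0 := by
      obtain ⟨z, hz⟩ : ∃ z : ℤ, (z : ℝ) = ⟪a, x - y⟫ := by
        rw [mem_integerLattice_iff] at ha hxy
        choose z hz using ha
        choose w hw using hxy
        refine ⟨∑ i, z i * w i, ?_⟩
        rw [PiLp.inner_apply]
        push_cast
        refine Finset.sum_congr rfl fun i _ => ?_
        rw [hz, hw]
        simp [mul_comm]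
      rw [hae, real_inner_smul_left] at hz
      have habs : |⟪e, x - y⟫| < ‖a‖⁻¹ := by
        rw [inner_sub_right, abs_lt]
        constructor <;> linarith
      have hz1 : |(z : ℝ)| < 1 := by
        rw [hz, abs_mul, abs_of_pos hna]
        calc ‖a‖ * |⟪e, x - y⟫| < ‖a‖ * ‖a‖⁻¹ := by gcongr
          _ = 1 := mul_inv_cancel₀ hna.ne'
      have hz0 : z = 0 := Int.abs_lt_one_iff.1 (by exact_mod_cast hz1)
      rw [hz0, Int.cast_zero, eq_comm, mul_eq_zero] at hz
      exact hz.resolve_left hna.ne'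
    have hfst : (F (x - y)).1 = 0 := by
      obtain ⟨t, ht⟩ := Submodule.mem_span_singleton.1 (F (x - y)).1.2
      have h1 := hinner (x - y)
      rw [hzero, ← ht, inner_smul_right, real_inner_self_eq_norm_sq, he] at h1
      have ht0 : t = 0 := by simpa using h1
      rw [ht0, zero_smul] at ht
      exact Subtype.ext ht.symm
    have hFsub : F (x - y) = F x - F y := by
      change (K.orthogonalDecomposition (x - y)).ofLp = _
      rw [map_sub]
      rfl
    have hsnd : (((F x).2 - (F y).2 : Kᗮ) : EuclideanSpace ℝ (Fin d)) = x - y := by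
      have h1 := hFx (x - y)
      rw [hfst, hFsub] at h1
      simpa using h1
    have h2 := hdiff _ hxA _ hyA (hsnd ▸ hxy)
    rw [h2, sub_self] at hsnd
    exact (sub_eq_zero.1 hsnd.symm)
  rw [hF.measure_preimage (hSm.prod hA).nullMeasurableSet, Measure.volume_eq_prod,
    Measure.prod_prod, hSvol, ENNReal.ofReal_inv_of_pos hna] at hone
  have hne : ENNReal.ofReal ‖a‖ ≠ 0 := by simpa using hna.ne'
  calc volume A = ENNReal.ofReal ‖a‖ * ((ENNReal.ofReal ‖a‖)⁻¹ * volume A) := by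
        rw [← mul_assoc, ENNReal.mul_inv_cancel hne ENNReal.ofReal_ne_top, one_mul]
    _ ≤ ENNReal.ofReal ‖a‖ * 1 := by gcongr
    _ = _ := mul_one _

/-- The integer points orthogonal to a nonzero integer vector span its orthogonal complement:
the vectors `a i • e_j - a j • e_i` for a fixed `i` with `a i ≠ 0` suffice. -/
theorem span_integer_points_orthogonal {d : ℕ} {e a : EuclideanSpace ℝ (Fin d)}
    (ha : a ∈ integerLattice d) (ha0 : a ≠ 0) (hae : a = ‖a‖ • e) :
    Submodule.span ℝ {x : (Submodule.span ℝ {e})ᗮ |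
      (x : EuclideanSpace ℝ (Fin d)) ∈ integerLattice d} = ⊤ := by
  have hna : ‖a‖ ≠ 0 := norm_ne_zero_iff.2 ha0
  have horth : ∀ x, x ∈ (Submodule.span ℝ {e})ᗮ ↔ ⟪a, x⟫ = 0 := by
    intro x
    rw [Submodule.mem_orthogonal_singleton_iff_inner_right, hae, real_inner_smul_left]
    simp [hna]
  obtain ⟨i, hi⟩ : ∃ i, a i ≠ 0 := by
    by_contra! h
    exact ha0 (PiLp.ext h)
  let w : Fin d → EuclideanSpace ℝ (Fin d) := fun j =>
    a i • EuclideanSpace.single j 1 - a j • EuclideanSpace.single i 1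
  have hw : ∀ j, w j ∈ (Submodule.span ℝ {e})ᗮ := by
    intro j
    rw [horth]
    simp only [w, inner_sub_right, inner_smul_right, EuclideanSpace.inner_single_right]
    simp [mul_comm]
  have hwL : ∀ j, w j ∈ integerLattice d := by
    rw [mem_integerLattice_iff] at ha
    choose z hz using ha
    intro j
    rw [mem_integerLattice_iff]
    intro l
    refine ⟨z i * (if l = j then 1 else 0) - z j * (if l = i then 1 else 0), ?_⟩
    simp [w, hz]
  rw [eq_top_iff]
  rintro x -
  have hx : ∑ j, a j * (x : EuclideanSpace ℝ (Fin d)) j = 0 := by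
    have := (horth x).1 x.2
    rw [PiLp.inner_apply] at this
    simpa [mul_comm] using this
  have hxw : x = (a i)⁻¹ • ∑ j, (x : EuclideanSpace ℝ (Fin d)) j • (⟨w j, hw j⟩ :
      (Submodule.span ℝ {e})ᗮ) := by
    rw [eq_inv_smul_iff₀ hi]
    ext l
    simp only [Submodule.coe_smul, Submodule.coe_sum, PiLp.smul_apply, WithLp.ofLp_sum,
      Finset.sum_apply, w, PiLp.sub_apply, smul_eq_mul, PiLp.single_apply]
    simp only [mul_sub, Finset.sum_sub_distrib, ← mul_assoc, ← Finset.sum_mul]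
    rw [show ∑ j, (x : EuclideanSpace ℝ (Fin d)) j * a j = 0 by simpa [mul_comm] using hx]
    simp [mul_comm]
  rw [hxw]
  exact Submodule.smul_mem _ _ (Submodule.sum_mem _ fun j _ =>
    Submodule.smul_mem _ _ (Submodule.subset_span (hwL j)))

/-! ### Parallelepipeds as unit balls of norms -/

theorem IsSymmParallelepiped.exists_seminorm {d : ℕ} {P : Set (EuclideanSpace ℝ (Fin d))}
    (hP : IsSymmParallelepiped P) :
    ∃ p : Seminorm ℝ (EuclideanSpace ℝ (Fin d)), Continuous p ∧ (∀ x, p x = 0 → x = 0) ∧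
      (∀ C, Bornology.IsBounded {x | p x ≤ C}) ∧ P = {x | p x ≤ 1} := by
  obtain ⟨A, rfl⟩ := hP
  let f : EuclideanSpace ℝ (Fin d) ≃ₗ[ℝ] (Fin d → ℝ) :=
    A.symm.trans (WithLp.linearEquiv 2 ℝ (Fin d → ℝ))
  let p : Seminorm ℝ (EuclideanSpace ℝ (Fin d)) :=
    (normSeminorm ℝ (Fin d → ℝ)).comp f.toLinearMap
  have hp : ∀ x, p x = ‖f x‖ := fun x => rfl
  have hf : Continuous f := f.toLinearMap.continuous_of_finiteDimensional
  refine ⟨p, ?_, ?_, ?_, ?_⟩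
  · exact (continuous_norm.comp hf :)
  · intro x hx
    rw [hp, norm_eq_zero] at hx
    exact f.map_eq_zero_iff.1 hx
  · intro C
    have h1 := (f.symm.toContinuousLinearEquiv.lipschitz.isBounded_image
      (Metric.isBounded_closedBall (x := (0 : Fin d → ℝ)) (r := C)))
    refine h1.subset fun x hx => ⟨f x, ?_, f.symm_apply_apply x⟩
    rw [mem_closedBall_zero_iff, ← hp]
    exact hx
  · ext x
    have h1 : x ∈ A '' cube d ↔ A.symm x ∈ cube d := by
      constructor
      · rintro ⟨y, hy, rfl⟩
        simpa using hy
      · exact fun h => ⟨_, h, A.apply_symm_apply x⟩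
    rw [h1, Set.mem_ofPred_eq, hp, pi_norm_le_iff_of_nonneg zero_le_one]
    rfl

theorem addHaar_seminorm_le_one {E : Type*} [NormedAddCommGroup E] [NormedSpace ℝ E]
    [FiniteDimensional ℝ E] [MeasurableSpace E] [BorelSpace E] (μ : Measure E)
    [μ.IsAddHaarMeasure] (p : Seminorm ℝ E) (hpc : Continuous p) :
    μ {x | p x ≤ 1} = μ (p.ball 0 1) := by
  have hball : p.ball 0 1 = {x | p x < 1} := p.ball_zero_eq
  have hopen : IsOpen (p.ball 0 1) := by
    rw [hball]
    exact isOpen_lt hpc continuous_const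
  refine le_antisymm ?_ (measure_mono ?_)
  · have hsub : {x | p x ≤ 1} ⊆ closure (p.ball 0 1) := by
      intro x hx
      have hlim : Filter.Tendsto (fun t : ℝ => t • x) (nhdsWithin 1 (Set.Iio 1)) (nhds x) := by
        have : Filter.Tendsto (fun t : ℝ => t • x) (nhds 1) (nhds ((1 : ℝ) • x)) :=
          (by fun_prop : Continuous fun t : ℝ => t • x).tendsto 1
        rw [one_smul] at this
        exact this.mono_left nhdsWithin_le_nhds
      refine mem_closure_of_tendsto hlim ?_
      filter_upwards [Ioo_mem_nhdsLT (zero_lt_one' ℝ)] with t ht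
      rw [Seminorm.mem_ball_zero, map_smul_eq_mul, Real.norm_of_nonneg ht.1.le]
      have hx' : p x ≤ 1 := hx
      nlinarith [ht.1, ht.2]
    calc μ {x | p x ≤ 1} ≤ μ (closure (p.ball 0 1)) := measure_mono hsub
      _ ≤ μ (p.ball 0 1 ∪ frontier (p.ball 0 1)) := by
        rw [← closure_eq_self_union_frontier]
      _ ≤ μ (p.ball 0 1) + μ (frontier (p.ball 0 1)) := measure_union_le _ _
      _ = μ (p.ball 0 1) := by
        rw [(p.convex_ball 0 1).addHaar_frontier μ, add_zero]
  · intro x hx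
    rw [p.mem_ball_zero] at hx
    exact hx.le

theorem sectionVolume_pos {d : ℕ} {P : Set (EuclideanSpace ℝ (Fin d))}
    (hP : IsSymmParallelepiped P) (e : EuclideanSpace ℝ (Fin d)) : 0 < sectionVolume P e := by
  obtain ⟨p, hpc, -, hbdd, rfl⟩ := hP.exists_seminorm
  refine ENNReal.toReal_pos ?_ ?_
  · refine ((IsOpen.measure_pos (U := {x : (Submodule.span ℝ {e})ᗮ | p x < 1}) volume
      (isOpen_lt (hpc.comp continuous_subtype_val) continuous_const) ⟨0, ?_⟩).trans_le
      (measure_mono ?_)).ne'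
    · simp
    · intro x hx
      rw [Set.mem_ofPred_eq] at hx
      exact hx.le
  · refine (Bornology.IsBounded.measure_lt_top ?_).ne
    obtain ⟨C, hC⟩ := isBounded_iff_forall_norm_le.1 (hbdd 1)
    exact isBounded_iff_forall_norm_le.2 ⟨C, fun x hx => hC x hx⟩

/-! ### The transference inequality -/

theorem successiveMin_nonneg {d : ℕ} (M : Set (EuclideanSpace ℝ (Fin d)))
    (L : Submodule ℤ (EuclideanSpace ℝ (Fin d))) (k : ℕ) : 0 ≤ successiveMin M L k :=
  Real.sInf_nonneg fun _ h => h.1.le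

/-- Minkowski's second theorem for the section of `P` by the hyperplane orthogonal to an integer
vector `a` and the integer points of that hyperplane. -/
theorem prod_successiveMin_mul_sectionVolume_le {n : ℕ}
    {P : Set (EuclideanSpace ℝ (Fin (n + 2)))} (hP : IsSymmParallelepiped P)
    {e a : EuclideanSpace ℝ (Fin (n + 2))} (he : ‖e‖ = 1) (ha : a ∈ integerLattice (n + 2))
    (ha0 : a ≠ 0) (hae : a = ‖a‖ • e) :
    (∏ k ∈ Finset.range (n + 1), successiveMin P (integerLattice (n + 2)) (k + 1)) *
      sectionVolume P e ≤ 2 ^ (n + 1) * ‖a‖ := by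
  have hpos := sectionVolume_pos hP e
  obtain ⟨p, hpc, hp0, hbdd, hPp⟩ := hP.exists_seminorm
  let H := (Submodule.span ℝ {e})ᗮ
  have hrank : Module.finrank ℝ H = n + 1 := by
    have : Fact (Module.finrank ℝ (EuclideanSpace ℝ (Fin (n + 2))) = (n + 1) + 1) := ⟨by simp⟩
    exact Submodule.finrank_orthogonal_span_singleton
      (norm_ne_zero_iff.1 (he ▸ one_ne_zero : ‖e‖ ≠ 0))
  let q : Seminorm ℝ H := p.comp H.subtype
  have hq : ∀ x : H, q x = p x := fun _ => rfl
  have hqc : Continuous q := hpc.comp continuous_subtype_val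
  let L : Set H := {x | (x : EuclideanSpace ℝ (Fin (n + 2))) ∈ integerLattice (n + 2)}
  have hfin : ∀ C, {x ∈ L | q x ≤ C}.Finite := by
    intro C
    have h1 := ZSpan.setFinite_inter (EuclideanSpace.basisFun (Fin (n + 2)) ℝ).toBasis (hbdd C)
    exact (h1.preimage Subtype.val_injective.injOn).subset fun x hx => ⟨hx.2, hx.1⟩
  obtain ⟨v, hvL, hvpos, hvmono, hvli, A, hAm, hAvol, hA⟩ := exists_minima_and_packing_set
    volume hrank q hqc (fun x hx => Subtype.ext (hp0 _ hx)) L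
    (span_integer_points_orthogonal ha ha0 hae) hfin
  have hvol := volume_le_norm_of_no_integer_difference he ha ha0 hae hAm hA
  have hsv : sectionVolume P e = (volume (q.ball 0 1)).toReal := by
    rw [← addHaar_seminorm_le_one volume q hqc, sectionVolume, hPp]
    rfl
  have hprod : 0 ≤ ∏ k ∈ Finset.range (n + 1), q (v k) / 2 :=
    Finset.prod_nonneg fun k _ => div_nonneg (apply_nonneg q _) zero_le_two
  have hbound : (∏ k ∈ Finset.range (n + 1), q (v k) / 2) * sectionVolume P e ≤ ‖a‖ := by
    have := ENNReal.toReal_mono ENNReal.ofReal_ne_top hvol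
    rwa [hAvol, ENNReal.toReal_mul, ENNReal.toReal_ofReal hprod, ← hsv,
      ENNReal.toReal_ofReal (norm_nonneg _)] at this
  have hmin : ∀ k ∈ Finset.range (n + 1),
      successiveMin P (integerLattice (n + 2)) (k + 1) ≤ q (v k) := by
    intro k hk
    have hk : k ≤ n := Nat.lt_succ_iff.1 (Finset.mem_range.1 hk)
    refine csInf_le ⟨0, fun _ h => h.1.le⟩ ⟨hvpos k hk, fun i : Fin (k + 1) => (v i : _), ?_, ?_⟩
    · have h1 := hvli.comp (Fin.castLE (Nat.succ_le_succ hk)) (Fin.castLE_injective _)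
      exact h1.map' H.subtype H.ker_subtype
    · intro i
      have hi : (i : ℕ) ≤ k := Nat.lt_succ_iff.1 i.2
      refine ⟨hvL i (hi.trans hk), ?_⟩
      rw [Set.mem_smul_set_iff_inv_smul_mem₀ (hvpos k hk).ne', hPp, Set.mem_ofPred_eq,
        map_smul_eq_mul, norm_inv, Real.norm_of_nonneg (hvpos k hk).le,
        inv_mul_le_one₀ (hvpos k hk)]
      exact hvmono k hk i hi
  calc _ ≤ (∏ k ∈ Finset.range (n + 1), q (v k)) * sectionVolume P e := by
        gcongr with k hk
        · exact fun k _ => successiveMin_nonneg _ _ _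
        · exact hmin k hk
    _ = 2 ^ (n + 1) * ((∏ k ∈ Finset.range (n + 1), q (v k) / 2) * sectionVolume P e) := by
        rw [Finset.prod_div_distrib, Finset.prod_const, Finset.card_range]
        field_simp
    _ ≤ _ := by gcongr

/-- A first successive minimum at most `1` gives a nonzero integer point `a` in `c • P^∧` for
every `c > 1`. The infimum is not taken over the empty set, which would make it the junk value
`0`: by `sectionVolume_pos` the section-dual contains a positive multiple of every unit
vector. -/
theorem exists_integer_point_of_successiveMin_sectionDual_le_one {n : ℕ}
    {P : Set (EuclideanSpace ℝ (Fin (n + 2)))} (hP : IsSymmParallelepiped P)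
    (h : successiveMin (sectionDual P) (integerLattice (n + 2)) 1 ≤ 1) {c : ℝ} (hc : 1 < c) :
    ∃ e a : EuclideanSpace ℝ (Fin (n + 2)), ‖e‖ = 1 ∧ a ∈ integerLattice (n + 2) ∧ a ≠ 0 ∧
      a = ‖a‖ • e ∧ 2 ^ (n + 1) * ‖a‖ ≤ c * sectionVolume P e := by
  have hpow : (2 : ℝ) ^ (1 - ((n + 2 : ℕ) : ℤ)) = (2 ^ (n + 1))⁻¹ := by
    rw [show (1 - ((n + 2 : ℕ) : ℤ)) = -((n + 1 : ℕ) : ℤ) by push_cast; ring, zpow_neg,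
      zpow_natCast]
  have hne : {μ : ℝ | 0 < μ ∧ ∃ v : Fin 1 → EuclideanSpace ℝ (Fin (n + 2)),
      LinearIndependent ℝ v ∧ ∀ i, v i ∈ integerLattice (n + 2) ∧
        v i ∈ μ • sectionDual P}.Nonempty := by
    let e : EuclideanSpace ℝ (Fin (n + 2)) := EuclideanSpace.single 0 1
    have he : ‖e‖ = 1 := by simp [e]
    have ht : 0 < (2 : ℝ) ^ (1 - ((n + 2 : ℕ) : ℤ)) * sectionVolume P e :=
      mul_pos (by positivity) (sectionVolume_pos hP e)
    refine ⟨_, inv_pos.2 ht, fun _ => e, ?_, fun _ => ⟨?_, ?_⟩⟩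
    · exact linearIndependent_unique_iff.2 (norm_ne_zero_iff.1 (he ▸ one_ne_zero : ‖e‖ ≠ 0))
    · rw [mem_integerLattice_iff]
      exact fun i => ⟨if i = 0 then 1 else 0, by simp [e]⟩
    · rw [Set.mem_smul_set_iff_inv_smul_mem₀ (inv_pos.2 ht).ne', inv_inv]
      exact ⟨e, mem_sphere_zero_iff_norm.2 he, _, ht.le, le_rfl, rfl⟩
  obtain ⟨μ, ⟨hμ, v, hv, hvL⟩, hμc⟩ := exists_lt_of_csInf_lt hne (h.trans_lt hc)
  obtain ⟨hL, x, ⟨e, he, t, ht0, ht, rfl⟩, hx⟩ := hvL 0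
  rw [mem_sphere_zero_iff_norm] at he
  have hx' : v 0 = (μ * t) • e := by rw [← hx, ← smul_smul]
  have hnorm : ‖v 0‖ = μ * t := by
    rw [hx', norm_smul, he, mul_one, Real.norm_of_nonneg (by positivity)]
  refine ⟨e, v 0, he, hL, hv.ne_zero 0, hnorm ▸ hx', ?_⟩
  rw [hpow, ← div_eq_inv_mul, le_div_iff₀ (by positivity)] at ht
  calc 2 ^ (n + 1) * ‖v 0‖ = μ * (t * 2 ^ (n + 1)) := by rw [hnorm]; ring
    _ ≤ c * sectionVolume P e := by gcongr

end SectionDual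

theorem mainTheorem6 (d : ℕ) (P : Set (EuclideanSpace ℝ (Fin d)))
    (hP : SectionDual.IsSymmParallelepiped P)
    (h : SectionDual.successiveMin (SectionDual.sectionDual P)
      (SectionDual.integerLattice d) 1 ≤ 1) :
    ∏ k ∈ Finset.Icc 1 (d - 1),
      SectionDual.successiveMin P (SectionDual.integerLattice d) k ≤ 1 := by
  match d, P, hP, h with
  | 0, _, _, _ => simp
  | 1, _, _, _ => simp
  | n + 2, P, hP, h =>
    have hIcc : Finset.Icc 1 (n + 2 - 1) = (Finset.range (n + 1)).map (addRightEmbedding 1) := by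
      rw [Finset.range_eq_Ico, Finset.map_add_right_Ico]
      rfl
    rw [hIcc, Finset.prod_map]
    -- The infimum in `h` need not be known to be attained: bound the product by every `c > 1`.
    refine le_of_forall_gt_imp_ge_of_dense fun c hc => ?_
    obtain ⟨e, a, he, ha, ha0, hae, hle⟩ :=
      SectionDual.exists_integer_point_of_successiveMin_sectionDual_le_one hP h hc
    exact le_of_mul_le_mul_right
      ((SectionDual.prod_successiveMin_mul_sectionVolume_le hP he ha ha0 hae).trans hle)
      (SectionDual.sectionVolume_pos hP e)
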